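/- Let $L$ channels be available to a user, with complex channel gains $h_1,\dots,h_L$ under Nakagami-$m$ fading with shape $m>0$ and mean power gain $\lambda>0$: for each $l$, $|h_l|^2$ has the Gamma density $\left(\frac{m}{\lambda}\right)^m\frac{x^{m-1}}{\Gamma(m)}e^{-mx/\lambda}$ on $(0,\infty)$. Let the user transmit with power $\Omega_k>0$ under noise power $\delta^2>0$, over a channel $c$ that is chosen at random, independently of $(h_1,\dots,h_L)$, among the free channels (those neither jammed nor used by other users). Then the instantaneous rate $\log_2\left(1+\frac{\Omega_k|h_c|^2}{\delta^2}\right)$ is integrable and the ergodic rate of the user is $$R'_{ek}=\mathbb{E}\left[\log_2\left(1+\frac{\Omega_k|h_c|^2}{\delta^2}\right)\right]=\frac{1}{\Gamma(m)\ln 2}\,G^{3,1}_{2,3}\left(\frac{\delta^2 m}{\Omega_k\lambda}\,\middle|\,\begin{matrix}0,\,1\\ 0,\,0,\,m\end{matrix}\right).$$ Here $G$ is the Meijer G-function, that is, for $z>0$, $$G^{3,1}_{2,3}\left(z\,\middle|\,\begin{matrix}0,\,1\\ 0,\,0,\,m\end{matrix}\right)=\frac{1}{2\pi i}\int_{\sigma-i\infty}^{\sigma+i\infty}\frac{\Gamma(-s)^2\,\Gamma(m-s)\,\Gamma(1+s)}{\Gamma(1-s)}\,z^s\,ds,$$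 where the integral converges absolutely and has the same value for every $\sigma\in(-1,0)$; these are the vertical lines that separate the poles of $\Gamma(-s)^2\Gamma(m-s)$ from those of $\Gamma(1+s)$. -/

import Mathlib

open MeasureTheory ProbabilityTheory

noncomputable section

/-- The Mellin--Barnes integrand of the Meijer function `G^{M,N}_{p,q}(z | a ; b)`:
`∏_{j ≤ M} Γ(b_j - s) ∏_{j ≤ N} Γ(1 - a_j + s)
  / (∏_{j > M} Γ(1 - b_j + s) ∏_{j > N} Γ(a_j - s)) * z ^ s`.
At a pole of a Gamma factor of the denominator, Mathlib's `Γ` is `0` and so is its inverse,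
which is the value of the entire function `1 / Γ` there. -/
def meijerGIntegrand (M N : ℕ) {p q : ℕ} (a : Fin p → ℂ) (b : Fin q → ℂ) (z s : ℂ) : ℂ :=
  (∏ j : Fin q, if (j : ℕ) < M then Complex.Gamma (b j - s)
    else (Complex.Gamma (1 - b j + s))⁻¹) *
  (∏ j : Fin p, if (j : ℕ) < N then Complex.Gamma (1 - a j + s)
    else (Complex.Gamma (a j - s))⁻¹) * z ^ s

/-- The upward vertical line `Re s = σ` separates the poles of the numerator: the poles
`b_j + k` of `Γ(b_j - s)`, `j ≤ M`, lie to its right, and the poles `a_j - 1 - k` of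
`Γ(1 - a_j + s)`, `j ≤ N`, lie to its left. -/
def SeparatesPoles (M N : ℕ) {p q : ℕ} (a : Fin p → ℂ) (b : Fin q → ℂ) (σ : ℝ) : Prop :=
  (∀ j : Fin q, (j : ℕ) < M → ∀ k : ℕ, σ < (b j + k).re) ∧
  (∀ j : Fin p, (j : ℕ) < N → ∀ k : ℕ, (a j - 1 - k).re < σ)

/-- `(1 / (2 π i)) ∫ meijerGIntegrand ds` along the line `s = σ + i t`, `ds = i dt`. -/
def meijerGLine (M N : ℕ) {p q : ℕ} (a : Fin p → ℂ) (b : Fin q → ℂ) (σ : ℝ) (z : ℂ) : ℂ :=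
  (1 / (2 * (Real.pi : ℂ) * Complex.I)) *
    ∫ t : ℝ, meijerGIntegrand M N a b z ((σ : ℂ) + (t : ℂ) * Complex.I) * Complex.I

open Classical in
/-- The Meijer function `G^{M,N}_{p,q}(z | a ; b)` as a Mellin--Barnes integral along a vertical
line that separates the two families of poles, for parameters that admit such a line
(the junk value is `0` for other parameters). Independence of the choice of the line is part of
`MeijerGWellDefined`. -/
def meijerG (M N : ℕ) {p q : ℕ} (a : Fin p → ℂ) (b : Fin q → ℂ) (z : ℂ) : ℂ :=
  if h : ∃ σ : ℝ, SeparatesPoles M N a b σ then meijerGLine M N a b h.choose z else 0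

/-- The Mellin--Barnes integral that defines `meijerG` at `z` makes sense: there is a separating
vertical line, and along every such line the integral converges absolutely and has the value
`meijerG M N a b z`. -/
def MeijerGWellDefined (M N : ℕ) {p q : ℕ} (a : Fin p → ℂ) (b : Fin q → ℂ) (z : ℂ) : Prop :=
  (∃ σ : ℝ, SeparatesPoles M N a b σ) ∧
  ∀ σ : ℝ, SeparatesPoles M N a b σ →
    Integrable (fun t : ℝ => meijerGIntegrand M N a b z ((σ : ℂ) + (t : ℂ) * Complex.I)) ∧
    meijerGLine M N a b σ z = meijerG M N a b z

/-- The complex channel gain `h` is subject to Nakagami-`m` fading with average power gain `lam`: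
the power gain `|h|²` has the Gamma density
`(m / lam) ^ m * x ^ (m - 1) / Γ(m) * exp (- m x / lam)` on `x ≥ 0`. -/
def IsNakagamiFading {Ω : Type*} [MeasurableSpace Ω] (P : Measure Ω) (m lam : ℝ)
    (h : Ω → ℂ) : Prop :=
  Measurable h ∧ HasLaw (fun ω => ‖h ω‖ ^ 2) (gammaMeasure m (m / lam)) P

/-- The instantaneous rate of a user of power `pw` with noise power `δ²` that transmits over the
channel `c ω`: it is `log₂ (1 + pw |h_c|² / δ²)` if that channel is free (neither jammed nor used
by another user), and `0` otherwise. -/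
def instantaneousRate {Ω : Type*} {L : ℕ} (free : Finset (Fin L)) (h : Fin L → Ω → ℂ)
    (pw δ : ℝ) (c : Ω → Fin L) (ω : Ω) : ℝ :=
  (if c ω ∈ free then 1 else 0) * Real.logb 2 (1 + pw * ‖h (c ω) ω‖ ^ 2 / δ ^ 2)

/-- The ergodic rate: the expectation of the instantaneous rate. -/
def ergodicRate {Ω : Type*} [MeasurableSpace Ω] (P : Measure Ω) {L : ℕ} (free : Finset (Fin L))
    (h : Fin L → Ω → ℂ) (pw δ : ℝ) (c : Ω → Fin L) : ℝ :=
  ∫ ω, instantaneousRate free h pw δ c ω ∂P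

end

/-!
The rate sees the channels only through the power gain `X = |h_c|²`, and since `c` is independent of
the gains, which all have the same law, `X` has the Gamma law of shape `m` and rate `r = m / lam`
(`integral_randomIndex`). With `g = pw / δ²` and `z = r / g`, it remains to compute
`𝔼 log (1 + g X)`.

By parts and by the Beta integral on `(0, ∞)`, the Mellin transform of `log (1 + x)` at `s` is
`K(s) = Γ(-s) Γ(1 + s) / (-s)` for `-1 < Re s < 0` (`mellin_log_one_add`). It is `O(|s|⁻²)` on
vertical lines (`norm_mellinKernel_le`), so Mellin inversion gives, for every `σ ∈ (-1, 0)`,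
`log (1 + x) = (2π)⁻¹ ∫ x ^ (-s) K(s) dt` with `s = σ + i t` (`log_one_add_eq_integral`).

Put `x = g X`, take expectations and exchange the integrals. The complex moment
`𝔼 X ^ (-s) = r ^ s Γ(m - s) / Γ(m)` (`integral_cpow_gammaMeasure`) turns the integrand into
`K(s) Γ(m - s) z ^ s / Γ(m)`, and since `Γ(1 - s) = -s Γ(-s)`, `K(s) Γ(m - s) z ^ s` is the
Mellin–Barnes integrand of the Meijer function (`meijerGIntegrand_eq`). The value of the
Mellin–Barnes integral is thus `Γ(m) 𝔼 log (1 + g X)` on each separating line, which also shows that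
it does not depend on the line; no contour has to be shifted.
-/

open Set Filter Topology Asymptotics

/-! ### The Mellin transform of `log (1 + x)` -/

/-- The Beta integral over `(0, ∞)`, by the substitution `y = x / (1 + x)`. -/
theorem betaIntegral_eq_integral_Ioi (a b : ℂ) :
    Complex.betaIntegral a b =
      ∫ x in Ioi (0 : ℝ), (x : ℂ) ^ (a - 1) * ((1 + x : ℝ) : ℂ) ^ (-(a + b)) := by
  have himage : (fun x : ℝ => x / (1 + x)) '' Ioi 0 = Ioo 0 1 := by
    ext y
    simp only [mem_image, mem_Ioi, mem_Ioo]
    constructor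
    · rintro ⟨x, hx, rfl⟩
      exact ⟨by positivity, by rw [div_lt_one (by positivity)]; linarith⟩
    · rintro ⟨h0, h1⟩
      have : (1 - y) ≠ 0 := by linarith
      exact ⟨y / (1 - y), div_pos h0 (by linarith), by field_simp; ring⟩
  have hinj : InjOn (fun x : ℝ => x / (1 + x)) (Ioi 0) := by
    intro x hx y hy hxy
    simp only [mem_Ioi] at hx hy
    have h1 : 1 + x ≠ 0 := by positivity
    have h2 : 1 + y ≠ 0 := by positivity
    simp only at hxy
    field_simp at hxy
    linarith
  have hderiv : ∀ x ∈ Ioi (0 : ℝ),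
      HasDerivWithinAt (fun x : ℝ => x / (1 + x)) (1 / (1 + x) ^ 2) (Ioi 0) x := by
    intro x hx
    simp only [mem_Ioi] at hx
    have h1 : 1 + x ≠ 0 := by positivity
    have := (hasDerivAt_id x).div ((hasDerivAt_id x).const_add 1) h1
    refine HasDerivAt.hasDerivWithinAt ?_
    exact this.congr_deriv (by simp)
  rw [Complex.betaIntegral, intervalIntegral.integral_of_le zero_le_one,
    integral_Ioc_eq_integral_Ioo, ← himage,
    integral_image_eq_integral_abs_deriv_smul measurableSet_Ioi hderiv hinj]
  refine setIntegral_congr_fun measurableSet_Ioi fun x hx => ?_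
  simp only [mem_Ioi] at hx
  have h1 : 0 < 1 + x := by positivity
  have h1c : ((1 + x : ℝ) : ℂ) ≠ 0 := by exact_mod_cast h1.ne'
  have e1 : ((x / (1 + x) : ℝ) : ℂ) ^ (a - 1) =
      (x : ℂ) ^ (a - 1) * ((1 + x : ℝ) : ℂ) ^ (-(a - 1)) := by
    rw [div_eq_mul_inv, Complex.ofReal_mul, Complex.mul_cpow_ofReal_nonneg hx.le (by positivity),
      Complex.ofReal_inv, Complex.inv_cpow _ _ ?_, Complex.cpow_neg]
    rw [Complex.arg_ofReal_of_nonneg h1.le]; exact Real.pi_pos.ne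
  have e2 : (1 - ((x / (1 + x) : ℝ) : ℂ)) ^ (b - 1) = ((1 + x : ℝ) : ℂ) ^ (-(b - 1)) := by
    have : (1 - ((x / (1 + x) : ℝ) : ℂ)) = (((1 + x)⁻¹ : ℝ) : ℂ) := by
      rw [← Complex.ofReal_one, ← Complex.ofReal_sub]
      congr 1; field_simp; ring
    rw [this, Complex.ofReal_inv, Complex.inv_cpow _ _ ?_, Complex.cpow_neg]
    rw [Complex.arg_ofReal_of_nonneg h1.le]; exact Real.pi_pos.ne
  have e3 : ((1 / (1 + x) ^ 2 : ℝ) : ℂ) = ((1 + x : ℝ) : ℂ) ^ (-2 : ℂ) := by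
    rw [Complex.cpow_neg]
    norm_cast
    simp
  rw [e1, e2, abs_of_pos (by positivity), Complex.real_smul, e3,
    show -(a + b) = -2 + (-(a - 1) + -(b - 1)) by ring, Complex.cpow_add _ _ h1c,
    Complex.cpow_add _ _ h1c]
  ring

theorem mellin_inv_one_add {s : ℂ} (h0 : 0 < s.re) (h1 : s.re < 1) :
    mellin (fun x : ℝ => ((1 + x : ℝ) : ℂ)⁻¹) s = Complex.Gamma s * Complex.Gamma (1 - s) := by
  rw [Complex.Gamma_mul_Gamma_eq_betaIntegral h0 (by simpa using h1), betaIntegral_eq_integral_Ioi]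
  simp [mellin, Complex.cpow_neg_one]

theorem mellinConvergent_inv_one_add {s : ℂ} (h0 : 0 < s.re) (h1 : s.re < 1) :
    MellinConvergent (fun x : ℝ => ((1 + x : ℝ) : ℂ)⁻¹) s := by
  refine mellinConvergent_of_isBigO_rpow (a := 1) (b := 0) ?_ ?_ h1 ?_ h0
  · refine ContinuousOn.locallyIntegrableOn ?_ measurableSet_Ioi
    refine ContinuousOn.inv₀ (by fun_prop) fun x hx => ?_
    simp only [mem_Ioi] at hx
    exact_mod_cast (by positivity : (1 + x) ≠ 0)
  · refine IsBigO.of_bound 1 ?_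
    filter_upwards [eventually_gt_atTop 0] with x hx
    rw [norm_inv, Complex.norm_real, Real.norm_of_nonneg (by positivity), Real.rpow_neg_one,
      Real.norm_of_nonneg (by positivity), one_mul]
    gcongr; linarith
  · refine IsBigO.of_bound 1 ?_
    filter_upwards [self_mem_nhdsWithin] with x hx
    simp only [mem_Ioi] at hx
    rw [norm_inv, Complex.norm_real, Real.norm_of_nonneg (by positivity)]
    simp only [neg_zero, Real.rpow_zero, norm_one, mul_one]
    exact inv_le_one_of_one_le₀ (by linarith)

theorem isBigO_log_one_add_atTop {ε : ℝ} (hε : 0 < ε) :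
    (fun x : ℝ => ((Real.log (1 + x) : ℝ) : ℂ)) =O[atTop] fun x : ℝ => x ^ ε := by
  refine IsBigO.trans (IsBigO.of_norm_left (g := fun x : ℝ => Real.log (1 + x)) ?_) ?_
  · simpa using (isBigO_refl (fun x : ℝ => Real.log (1 + x)) atTop)
  · have h := (isLittleO_log_rpow_atTop hε).isBigO.comp_tendsto
      (tendsto_atTop_add_const_left atTop (1 : ℝ) tendsto_id)
    refine h.trans (IsBigO.of_bound (2 ^ ε) ?_)
    filter_upwards [eventually_ge_atTop 1] with x hx
    simp only [Function.comp, id]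
    rw [Real.norm_of_nonneg (by positivity), Real.norm_of_nonneg (by positivity),
      ← Real.mul_rpow (by norm_num) (by linarith)]
    exact Real.rpow_le_rpow (by linarith) (by linarith) hε.le

theorem isBigO_log_one_add_nhdsGT_zero :
    (fun x : ℝ => ((Real.log (1 + x) : ℝ) : ℂ)) =O[𝓝[>] 0] fun x : ℝ => x ^ (1 : ℝ) := by
  refine IsBigO.of_bound 1 ?_
  filter_upwards [self_mem_nhdsWithin] with x hx
  simp only [mem_Ioi] at hx
  rw [Complex.norm_real, Real.norm_of_nonneg (Real.log_nonneg (by linarith)), Real.rpow_one,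
    Real.norm_of_nonneg hx.le, one_mul]
  linarith [Real.log_le_sub_one_of_pos (show 0 < 1 + x by linarith)]

theorem mellinConvergent_log_one_add {s : ℂ} (h1 : -1 < s.re) (h0 : s.re < 0) :
    MellinConvergent (fun x : ℝ => ((Real.log (1 + x) : ℝ) : ℂ)) s := by
  refine mellinConvergent_of_isBigO_rpow (a := s.re / 2) (b := -1) ?_ ?_ (by linarith) ?_ h1
  · refine ContinuousOn.locallyIntegrableOn ?_ measurableSet_Ioi
    refine Complex.continuous_ofReal.comp_continuousOn ?_
    refine ContinuousOn.log (by fun_prop) fun x hx => ?_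
    simp only [mem_Ioi] at hx
    positivity
  · exact isBigO_log_one_add_atTop (by linarith)
  · simpa using isBigO_log_one_add_nhdsGT_zero

/-- Integration by parts, with `x ^ s / s` as the antiderivative of `x ^ (s - 1)`, reduces the
transform to the one of `1 / (1 + x)` at `1 + s`. -/
theorem mellin_log_one_add {s : ℂ} (h1 : -1 < s.re) (h0 : s.re < 0) :
    mellin (fun x : ℝ => ((Real.log (1 + x) : ℝ) : ℂ)) s =
      Complex.Gamma (-s) * Complex.Gamma (1 + s) / (-s) := by
  have hs : s ≠ 0 := by rintro rfl; simp at h0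
  have hpow : ∀ x : ℝ, 0 < x → ‖(x : ℂ) ^ s / s‖ = x ^ s.re / ‖s‖ := fun x hx => by
    rw [norm_div, Complex.norm_cpow_eq_rpow_re_of_pos hx]
  -- The boundary terms vanish at `0` and at `∞` for the same reason: `log (1 + x) = O(x ^ d)` with
  -- `x ^ (d + Re s) → 0`, where `d = 1` at `0` and `d = -Re s / 2` at `∞`.
  have hlim : ∀ {l : Filter ℝ} {d : ℝ}, (∀ᶠ x in l, 0 < x) →
      (fun x : ℝ => ((Real.log (1 + x) : ℝ) : ℂ)) =O[l] (fun x : ℝ => x ^ d) →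
      Tendsto (fun x : ℝ => x ^ (d + s.re)) l (𝓝 0) →
      Tendsto ((fun x : ℝ => ((Real.log (1 + x) : ℝ) : ℂ)) * fun x : ℝ => (x : ℂ) ^ s / s)
        l (𝓝 0) := by
    intro l d hpos hO ht
    refine IsBigO.trans_tendsto (g'' := fun x : ℝ => x ^ d * x ^ s.re) ?_ ?_
    · refine hO.mul (IsBigO.of_bound (1 / ‖s‖) ?_)
      filter_upwards [hpos] with x hx
      rw [hpow x hx, Real.norm_of_nonneg (by positivity)]
      exact (by ring : _ = _).le
    · refine ht.congr' ?_
      filter_upwards [hpos] with x hx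
      rw [Real.rpow_add hx]
  have hparts := integral_Ioi_mul_deriv_eq_deriv_mul (a := 0)
    (u := fun x : ℝ => ((Real.log (1 + x) : ℝ) : ℂ))
    (v := fun x : ℝ => (x : ℂ) ^ s / s)
    (u' := fun x : ℝ => ((1 + x : ℝ) : ℂ)⁻¹) (v' := fun x : ℝ => (x : ℂ) ^ (s - 1))
    (a' := 0) (b' := 0) ?_ ?_ ?_ ?_ ?_ ?_
  · have e : ∫ x in Ioi (0 : ℝ), ((1 + x : ℝ) : ℂ)⁻¹ * ((x : ℂ) ^ s / s) =
        mellin (fun x : ℝ => ((1 + x : ℝ) : ℂ)⁻¹) (1 + s) / s := by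
      rw [mellin, ← integral_div]
      refine integral_congr_ae (ae_of_all _ fun x => ?_)
      simp only [smul_eq_mul, add_sub_cancel_left]
      ring
    rw [e, mellin_inv_one_add (by simpa using by linarith) (by simpa using h0)] at hparts
    rw [mellin]
    simp only [smul_eq_mul]
    simp_rw [mul_comm _ ((Real.log (1 + _) : ℝ) : ℂ)]
    rw [hparts, show 1 - (1 + s) = -s by ring]
    field_simp
    ring
  · intro x hx
    simp only [mem_Ioi] at hx
    have h := ((hasDerivAt_id x).const_add 1).log (by simp; positivity)
    have := h.ofReal_comp
    exact this.congr_deriv (by simp)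
  · intro x hx
    simp only [mem_Ioi] at hx
    have := (hasDerivAt_ofReal_cpow_const' hx.ne' (r := s - 1) (by
      intro h; apply hs; linear_combination h))
    simpa using this
  · refine (mellinConvergent_log_one_add h1 h0).congr_fun (fun x _ => ?_) measurableSet_Ioi
    simp [mul_comm]
  · refine ((mellinConvergent_inv_one_add (s := 1 + s) (by simpa using by linarith)
      (by simpa using h0)).div_const s).congr_fun (fun x _ => ?_) measurableSet_Ioi
    simp only [smul_eq_mul, add_sub_cancel_left, Pi.mul_apply]
    ring
  · refine hlim self_mem_nhdsWithin isBigO_log_one_add_nhdsGT_zero ?_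
    have := (Real.continuousAt_rpow_const 0 (1 + s.re) (Or.inr (by linarith))).tendsto
    rw [Real.zero_rpow (by linarith)] at this
    exact this.mono_left nhdsWithin_le_nhds
  · refine hlim (eventually_gt_atTop 0)
      (isBigO_log_one_add_atTop (ε := -s.re / 2) (by linarith)) ?_
    have := tendsto_rpow_neg_atTop (y := -s.re / 2) (by linarith)
    convert this using 3
    ring

/-! ### Mellin inversion for `log (1 + x)` -/

theorem norm_Gamma_le_Gamma_re {s : ℂ} (hs : 0 < s.re) :
    ‖Complex.Gamma s‖ ≤ Real.Gamma s.re := by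
  rw [Complex.Gamma_eq_integral hs, Real.Gamma_eq_integral hs, Complex.GammaIntegral]
  refine (norm_integral_le_integral_norm _).trans_eq ?_
  refine setIntegral_congr_fun measurableSet_Ioi fun x hx => ?_
  rw [norm_mul, Complex.norm_cpow_eq_rpow_re_of_pos hx, Complex.norm_real,
    Real.norm_of_nonneg (by positivity)]
  simp

theorem continuous_Gamma_comp {f : ℝ → ℂ} (hf : Continuous f) (hpos : ∀ t, 0 < (f t).re) :
    Continuous fun t => Complex.Gamma (f t) := by
  refine continuous_iff_continuousAt.2 fun t => ?_
  refine ContinuousAt.comp (g := Complex.Gamma) ?_ hf.continuousAt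
  refine (Complex.differentiableAt_Gamma _ fun n hn => ?_).continuousAt
  have := hpos t
  rw [hn] at this
  simp at this
  linarith [(Nat.cast_nonneg n : (0 : ℝ) ≤ n)]

theorem continuous_mellinKernel {σ : ℝ} (h1 : -1 < σ) (h0 : σ < 0) :
    Continuous fun t : ℝ => Complex.Gamma (-(σ + t * Complex.I)) *
      Complex.Gamma (1 + (σ + t * Complex.I)) / (-(σ + t * Complex.I)) := by
  refine Continuous.div (Continuous.mul (continuous_Gamma_comp (by fun_prop) fun t => ?_)
    (continuous_Gamma_comp (by fun_prop) fun t => ?_)) (by fun_prop) fun t h => ?_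
  · simpa using h0
  · simp; linarith
  · have := congrArg Complex.re h
    simp at this
    linarith

/-- Quadratic decay of the Mellin transform of `log (1 + x)` on vertical lines. The bound
`|Γ(s)| ≤ Γ(Re s)` has no decay in `Im s`; writing `Γ(-s) = Γ(1 - s) / (-s)` first gains the
factor `1 / |s|` that integrability needs. -/
theorem norm_mellinKernel_le {s : ℂ} (h1 : -1 < s.re) (h0 : s.re < 0) :
    ‖Complex.Gamma (-s) * Complex.Gamma (1 + s) / (-s)‖ ≤
      Real.Gamma (1 - s.re) * Real.Gamma (1 + s.re) * (‖s‖ ^ 2)⁻¹ := by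
  have hs : s ≠ 0 := by rintro rfl; simp at h0
  have h := Complex.Gamma_add_one (-s) (neg_ne_zero.2 hs)
  have e : Complex.Gamma (-s) = Complex.Gamma (1 - s) / (-s) := by
    rw [show 1 - s = -s + 1 by ring, h]
    field_simp
  rw [e, norm_div, norm_mul, norm_div, norm_neg]
  have g1 := norm_Gamma_le_Gamma_re (s := 1 - s) (by simp; linarith)
  have g2 := norm_Gamma_le_Gamma_re (s := 1 + s) (by simp; linarith)
  simp only [Complex.sub_re, Complex.add_re, Complex.one_re] at g1 g2
  calc _ = ‖Complex.Gamma (1 - s)‖ * ‖Complex.Gamma (1 + s)‖ * (‖s‖ ^ 2)⁻¹ := by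
        field_simp
    _ ≤ _ := by gcongr; exact (norm_nonneg _).trans g1

theorem integrable_mellinKernel {σ : ℝ} (h1 : -1 < σ) (h0 : σ < 0) :
    Integrable fun t : ℝ => Complex.Gamma (-(σ + t * Complex.I)) *
      Complex.Gamma (1 + (σ + t * Complex.I)) / (-(σ + t * Complex.I)) := by
  have hint : Integrable fun t : ℝ => Real.Gamma (1 - σ) * Real.Gamma (1 + σ) *
      ((σ ^ 2)⁻¹ * (1 + (t / σ) ^ 2)⁻¹) :=
    ((integrable_inv_one_add_sq.comp_div h0.ne).const_mul _).const_mul _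
  refine hint.mono' (continuous_mellinKernel h1 h0).aestronglyMeasurable (ae_of_all _ fun t => ?_)
  refine (norm_mellinKernel_le (by simpa using h1) (by simpa using h0)).trans_eq ?_
  have : ‖(σ + t * Complex.I : ℂ)‖ ^ 2 = σ ^ 2 * (1 + (t / σ) ^ 2) := by
    rw [← Complex.normSq_eq_norm_sq, Complex.normSq_add_mul_I]
    field_simp [h0.ne]
  rw [this, mul_inv]
  simp

theorem log_one_add_eq_integral {σ : ℝ} (h1 : -1 < σ) (h0 : σ < 0) {x : ℝ} (hx : 0 < x) :
    ((Real.log (1 + x) : ℝ) : ℂ) = 1 / (2 * Real.pi) *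
      ∫ t : ℝ, (x : ℂ) ^ (-(σ + t * Complex.I)) * (Complex.Gamma (-(σ + t * Complex.I)) *
      Complex.Gamma (1 + (σ + t * Complex.I)) / (-(σ + t * Complex.I))) := by
  have hm : ∀ t : ℝ, mellin (fun x : ℝ => ((Real.log (1 + x) : ℝ) : ℂ)) (σ + t * Complex.I) =
      Complex.Gamma (-(σ + t * Complex.I)) *
      Complex.Gamma (1 + (σ + t * Complex.I)) / (-(σ + t * Complex.I)) := fun t =>
    mellin_log_one_add (by simpa using h1) (by simpa using h0)
  have h := mellinInv_mellin_eq σ (fun x : ℝ => ((Real.log (1 + x) : ℝ) : ℂ)) hx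
    (mellinConvergent_log_one_add (by simpa using h1) (by simpa using h0))
    ((integrable_mellinKernel h1 h0).congr (ae_of_all _ fun t => (hm t).symm)) ?_
  · rw [← h, mellinInv]
    simp only [hm, smul_eq_mul, Complex.real_smul]
    norm_num
  · refine Complex.continuous_ofReal.continuousAt.comp ?_
    exact ContinuousAt.log (by fun_prop) (by positivity)

/-! ### Moments of the Gamma law -/

theorem ae_pos_gammaMeasure (a r : ℝ) : ∀ᵐ x ∂gammaMeasure a r, 0 < x := by
  rw [gammaMeasure, ae_withDensity_iff (by unfold gammaPDF; fun_prop)]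
  filter_upwards [compl_mem_ae_iff.2 (measure_singleton (0 : ℝ))] with x hx hpdf
  by_contra hneg
  have : x ≠ 0 := hx
  exact hpdf (gammaPDF_of_neg (lt_of_le_of_ne (not_lt.1 hneg) this))

theorem gammaMeasure_eq_withDensity (a r : ℝ) :
    gammaMeasure a r = (volume.restrict (Ioi 0)).withDensity fun x =>
      ENNReal.ofReal (r ^ a / Real.Gamma a * x ^ (a - 1) * Real.exp (-(r * x))) := by
  rw [gammaMeasure, Measure.restrict_congr_set (Ioi_ae_eq_Ici (a := 0)),
    ← withDensity_indicator measurableSet_Ici]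
  congr 1
  ext x
  by_cases hx : 0 ≤ x
  · rw [indicator_of_mem (mem_Ici.2 hx), gammaPDF_of_nonneg hx]
  · rw [indicator_of_notMem (by simpa using hx), gammaPDF_of_neg (not_le.1 hx)]

theorem integrable_rpow_gammaMeasure {a r q : ℝ} (ha : 0 < a) (hr : 0 < r) (hq : 0 < a + q) :
    Integrable (fun x : ℝ => x ^ q) (gammaMeasure a r) := by
  rw [gammaMeasure_eq_withDensity, integrable_withDensity_iff_integrable_smul' (by fun_prop)
    (by simp)]
  have h := (integrableOn_rpow_mul_exp_neg_mul_rpow (p := 1) (s := a + q - 1) (b := r)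
    (by linarith) one_pos hr).const_mul (r ^ a / Real.Gamma a)
  refine IntegrableOn.congr_fun h (fun x hx => ?_) measurableSet_Ioi
  simp only [mem_Ioi] at hx
  have hG := Real.Gamma_pos_of_pos ha
  rw [ENNReal.toReal_ofReal (by positivity), smul_eq_mul, Real.rpow_one,
    show a + q - 1 = (a - 1) + q by ring, Real.rpow_add hx]
  ring_nf

theorem integral_cpow_gammaMeasure {a r : ℝ} {w : ℂ} (ha : 0 < a) (hr : 0 < r)
    (hw : 0 < a + w.re) :
    ∫ x : ℝ, (x : ℂ) ^ w ∂gammaMeasure a r =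
      (r : ℂ) ^ (-w) * Complex.Gamma (a + w) / Complex.Gamma a := by
  rw [gammaMeasure_eq_withDensity, integral_withDensity_eq_integral_toReal_smul (by fun_prop)
    (by simp)]
  have hG := Real.Gamma_pos_of_pos ha
  have hrc : (r : ℂ) ≠ 0 := by exact_mod_cast hr.ne'
  have h := Complex.integral_cpow_mul_exp_neg_mul_Ioi (a := a + w) (r := r) (by simpa using hw)
    (by simpa using hr)
  have e : ∀ x ∈ Ioi (0 : ℝ),
      (ENNReal.ofReal (r ^ a / Real.Gamma a * x ^ (a - 1) * Real.exp (-(r * x)))).toReal •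
        (x : ℂ) ^ w = (r : ℂ) ^ (a : ℂ) / Complex.Gamma a *
          ((x : ℂ) ^ ((a : ℂ) + w - 1) * Complex.exp (-(r * x))) := by
    intro x hx
    simp only [mem_Ioi] at hx
    have hxc : (x : ℂ) ≠ 0 := by exact_mod_cast hx.ne'
    rw [ENNReal.toReal_ofReal (by positivity), Complex.real_smul,
      show (a : ℂ) + w - 1 = (a - 1) + w by ring, Complex.cpow_add _ _ hxc]
    push_cast [Complex.ofReal_cpow hr.le, Complex.ofReal_cpow hx.le, Complex.Gamma_ofReal]
    ring
  rw [setIntegral_congr_fun measurableSet_Ioi e, integral_const_mul, h, one_div,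
    Complex.inv_cpow _ _ (by rw [Complex.arg_ofReal_of_nonneg hr.le]; exact Real.pi_pos.ne),
    Complex.cpow_add _ _ hrc, Complex.cpow_neg]
  have : (r : ℂ) ^ (a : ℂ) ≠ 0 := by simp [Complex.cpow_eq_zero_iff, hrc]
  have : (r : ℂ) ^ w ≠ 0 := by simp [Complex.cpow_eq_zero_iff, hrc]
  field_simp

/-! ### The Mellin–Barnes integral as an expectation -/

theorem meijerGIntegrand_eq {m : ℝ} {z s : ℂ} (h0 : s.re < 0) :
    meijerGIntegrand 3 1 ![0, 1] ![0, 0, (m : ℂ)] z s =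
      Complex.Gamma (-s) * Complex.Gamma (1 + s) / (-s) * Complex.Gamma (m - s) * z ^ s := by
  have hs : -s ≠ 0 := by rw [neg_ne_zero]; rintro rfl; simp at h0
  have hG : Complex.Gamma (-s) ≠ 0 := Complex.Gamma_ne_zero_of_re_pos (by simpa using h0)
  have h : Complex.Gamma (1 - s) = -s * Complex.Gamma (-s) := by
    rw [← Complex.Gamma_add_one _ hs]; ring_nf
  simp only [meijerGIntegrand, Fin.prod_univ_three, Fin.prod_univ_two]
  simp [h]
  field_simp

theorem separatesPoles_iff {m σ : ℝ} (hm : 0 < m) :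
    SeparatesPoles 3 1 ![0, 1] ![0, 0, (m : ℂ)] σ ↔ -1 < σ ∧ σ < 0 := by
  simp only [SeparatesPoles, Fin.forall_fin_succ]
  simp
  constructor
  · rintro ⟨⟨h0, -⟩, h1⟩
    exact ⟨by simpa using h1 0, by simpa using h0 0⟩
  · rintro ⟨h1, h0⟩
    have hk (k : ℕ) : (0 : ℝ) ≤ k := Nat.cast_nonneg k
    exact ⟨⟨fun k => by linarith [hk k], fun k => by linarith [hk k]⟩,
      fun k => by linarith [hk k]⟩

theorem integrable_mellinBarnes {m z σ : ℝ} (hm : 0 < m) (hz : 0 < z) (h1 : -1 < σ)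
    (h0 : σ < 0) :
    Integrable fun t : ℝ => meijerGIntegrand 3 1 ![0, 1] ![0, 0, (m : ℂ)] z
      ((σ : ℂ) + (t : ℂ) * Complex.I) := by
  simp_rw [meijerGIntegrand_eq (s := (σ : ℂ) + (_ : ℂ) * Complex.I)
    (show ((σ : ℂ) + ((_ : ℝ) : ℂ) * Complex.I).re < 0 by simpa using h0), mul_assoc _ _ (_ ^ _)]
  have hzc : (z : ℂ) ≠ 0 := by exact_mod_cast hz.ne'
  refine (integrable_mellinKernel h1 h0).mul_bdd (c := Real.Gamma (m - σ) * z ^ σ) ?_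
    (ae_of_all _ fun t => ?_)
  · refine Continuous.aestronglyMeasurable (Continuous.mul
      (continuous_Gamma_comp (by fun_prop) fun t => ?_) ?_)
    · simp; linarith
    · exact Continuous.const_cpow (by fun_prop) (Or.inl hzc)
  · rw [norm_mul, Complex.norm_cpow_eq_rpow_re_of_pos hz]
    have := norm_Gamma_le_Gamma_re (s := m - (σ + t * Complex.I)) (by simp; linarith)
    simp at this ⊢
    gcongr

/-- The expectation of `log (1 + g X)` for a Gamma variable `X` is a Mellin–Barnes integral along any
line in the strip `-1 < Re s < 0`: insert the Mellin inversion formula and apply Fubini. -/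
theorem integral_log_one_add_gammaMeasure {m r g σ : ℝ} (hm : 0 < m) (hr : 0 < r) (hg : 0 < g)
    (h1 : -1 < σ) (h0 : σ < 0) :
    ((∫ x, Real.log (1 + g * x) ∂gammaMeasure m r : ℝ) : ℂ) = 1 / (Real.Gamma m : ℂ) *
      meijerGLine 3 1 ![0, 1] ![0, 0, (m : ℂ)] σ ((r / g : ℝ) : ℂ) := by
  have := isProbabilityMeasure_gammaMeasure hm hr
  set K : ℝ → ℂ := fun t => Complex.Gamma (-(σ + t * Complex.I)) *
      Complex.Gamma (1 + (σ + t * Complex.I)) / (-(σ + t * Complex.I)) with hK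
  have hKint : Integrable K := integrable_mellinKernel h1 h0
  have hprod : Integrable (fun p : ℝ × ℝ =>
      ((g * p.1 : ℝ) : ℂ) ^ (-((σ : ℂ) + (p.2 : ℂ) * Complex.I)) * K p.2)
      ((gammaMeasure m r).prod volume) := by
    have hb := ((integrable_rpow_gammaMeasure (q := -σ) hm hr (by linarith)).const_mul
      (g ^ (-σ))).mul_prod hKint.norm
    -- On a vertical line `|(g x) ^ (-s)| = (g x) ^ (-σ)` does not depend on `t`.
    refine hb.mono' ?_ ?_
    · refine AEStronglyMeasurable.mul ?_ hKint.aestronglyMeasurable.comp_snd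
      exact Measurable.aestronglyMeasurable (by fun_prop)
    · have hpos : ∀ᵐ p ∂(gammaMeasure m r).prod (volume : Measure ℝ), 0 < p.1 :=
        Measure.quasiMeasurePreserving_fst.ae (ae_pos_gammaMeasure m r)
      filter_upwards [hpos] with p hp
      rw [norm_mul, Complex.norm_cpow_eq_rpow_re_of_pos (by positivity)]
      simp [Real.mul_rpow hg.le hp.le]
  rw [← integral_complex_ofReal]
  calc ∫ x, ((Real.log (1 + g * x) : ℝ) : ℂ) ∂gammaMeasure m r
      = ∫ x, 1 / (2 * Real.pi) * (∫ t : ℝ,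
          ((g * x : ℝ) : ℂ) ^ (-((σ : ℂ) + (t : ℂ) * Complex.I)) * K t) ∂gammaMeasure m r := by
        refine integral_congr_ae ?_
        filter_upwards [ae_pos_gammaMeasure m r] with x hx
        exact log_one_add_eq_integral h1 h0 (by positivity)
    _ = 1 / (2 * Real.pi) * ∫ t : ℝ, (∫ x,
          ((g * x : ℝ) : ℂ) ^ (-((σ : ℂ) + (t : ℂ) * Complex.I)) * K t ∂gammaMeasure m r) := by
        rw [integral_const_mul, integral_integral_swap hprod]
    _ = 1 / (2 * Real.pi) * ∫ t : ℝ, 1 / (Real.Gamma m : ℂ) *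
          meijerGIntegrand 3 1 ![0, 1] ![0, 0, (m : ℂ)] ((r / g : ℝ) : ℂ)
            ((σ : ℂ) + (t : ℂ) * Complex.I) := by
        congr 2
        ext t
        set s : ℂ := (σ : ℂ) + (t : ℂ) * Complex.I with hs
        have hsre : s.re = σ := by simp [hs]
        have e : ∫ x : ℝ, ((g * x : ℝ) : ℂ) ^ (-s) * K t ∂gammaMeasure m r =
            ∫ x : ℝ, (g : ℂ) ^ (-s) * K t * (x : ℂ) ^ (-s) ∂gammaMeasure m r := by
          refine integral_congr_ae ?_
          filter_upwards [ae_pos_gammaMeasure m r] with x hx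
          rw [Complex.ofReal_mul, Complex.mul_cpow_ofReal_nonneg hg.le hx.le]
          ring
        have e2 : ((r / g : ℝ) : ℂ) ^ s = (r : ℂ) ^ s * (g : ℂ) ^ (-s) := by
          rw [div_eq_mul_inv, Complex.ofReal_mul,
            Complex.mul_cpow_ofReal_nonneg hr.le (by positivity), Complex.ofReal_inv,
            Complex.inv_cpow _ _ ?_, Complex.cpow_neg]
          rw [Complex.arg_ofReal_of_nonneg hg.le]; exact Real.pi_pos.ne
        rw [e, integral_const_mul, integral_cpow_gammaMeasure hm hr (by simp [hsre]; linarith),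
          meijerGIntegrand_eq (by rwa [hsre]), e2, neg_neg, Complex.Gamma_ofReal,
          ← sub_eq_add_neg]
        simp only [hK, ← hs]
        ring
    _ = _ := by
        have hI := Complex.I_ne_zero
        rw [meijerGLine, integral_const_mul, integral_mul_const]
        generalize ∫ t : ℝ, meijerGIntegrand 3 1 ![0, 1] ![0, 0, (m : ℂ)] ((r / g : ℝ) : ℂ)
            ((σ : ℂ) + (t : ℂ) * Complex.I) = J
        field_simp

/-- Independence of the line: the integral along each separating line is `Γ(m)` times the same
expectation `𝔼 log (1 + X)`, where `X` has the Gamma law of shape `m` and rate `z`. -/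
theorem meijerG_eq_line {m z σ : ℝ} (hm : 0 < m) (hz : 0 < z) (h1 : -1 < σ) (h0 : σ < 0) :
    meijerG 3 1 ![0, 1] ![0, 0, (m : ℂ)] z = meijerGLine 3 1 ![0, 1] ![0, 0, (m : ℂ)] σ z := by
  have hex : ∃ σ : ℝ, SeparatesPoles 3 1 ![0, 1] ![0, 0, (m : ℂ)] σ :=
    ⟨σ, (separatesPoles_iff hm).2 ⟨h1, h0⟩⟩
  obtain ⟨h1', h0'⟩ := (separatesPoles_iff hm).1 hex.choose_spec
  have hG : (Real.Gamma m : ℂ) ≠ 0 := by exact_mod_cast (Real.Gamma_pos_of_pos hm).ne'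
  have e1 := integral_log_one_add_gammaMeasure hm hz one_pos h1 h0
  have e2 := integral_log_one_add_gammaMeasure hm hz one_pos h1' h0'
  rw [e1, div_one] at e2
  rw [meijerG, dif_pos hex]
  exact (mul_left_cancel₀ (one_div_ne_zero hG) e2).symm

theorem meijerGWellDefined {m z : ℝ} (hm : 0 < m) (hz : 0 < z) :
    MeijerGWellDefined 3 1 ![0, 1] ![0, 0, (m : ℂ)] z := by
  refine ⟨⟨-1 / 2, (separatesPoles_iff hm).2 (by norm_num)⟩, fun σ hσ => ?_⟩
  obtain ⟨h1, h0⟩ := (separatesPoles_iff hm).1 hσ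
  exact ⟨integrable_mellinBarnes hm hz h1 h0, (meijerG_eq_line hm hz h1 h0).symm⟩

theorem integrable_log_one_add_gammaMeasure {m r g : ℝ} (hm : 0 < m) (hr : 0 < r)
    (hg : 0 < g) : Integrable (fun x => Real.log (1 + g * x)) (gammaMeasure m r) := by
  have h := (integrable_rpow_gammaMeasure (q := 1) hm hr (by linarith)).const_mul g
  refine h.mono' (Measurable.aestronglyMeasurable (by fun_prop)) ?_
  filter_upwards [ae_pos_gammaMeasure m r] with x hx
  have : 0 < g * x := by positivity
  rw [Real.norm_of_nonneg (Real.log_nonneg (by linarith)), Real.rpow_one]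
  linarith [Real.log_le_sub_one_of_pos (show 0 < 1 + g * x by linarith)]

/-! ### The randomly chosen channel -/

/-- A random index `c` that is independent of the family `X` does not change expectations: if all
`F (X i)` have the same expectation `I`, so has `F (X c)`. The variables `X i` need not be
independent of each other. -/
theorem integral_randomIndex {Ω ι E : Type*} [MeasurableSpace Ω] [MeasurableSpace E]
    [Fintype ι] [MeasurableSpace ι] [MeasurableSingletonClass ι] {P : Measure Ω}
    [IsProbabilityMeasure P] {c : Ω → ι} {X : ι → Ω → E} {F : E → ℝ} {I : ℝ}
    (hc : Measurable c) (hX : ∀ i, Measurable (X i)) (hF : Measurable F)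
    (hindep : IndepFun c (fun ω i => X i ω) P)
    (hint : ∀ i, Integrable (fun ω => F (X i ω)) P) (hI : ∀ i, ∫ ω, F (X i ω) ∂P = I) :
    Integrable (fun ω => F (X (c ω) ω)) P ∧ ∫ ω, F (X (c ω) ω) ∂P = I := by
  classical
  have hsum : (fun ω => F (X (c ω) ω)) =
      fun ω => ∑ i, (c ⁻¹' {i}).indicator (fun ω => F (X i ω)) ω := by
    ext ω
    simp [indicator_apply]
  have hterm (i : ι) : Integrable ((c ⁻¹' {i}).indicator fun ω => F (X i ω)) P :=
    (hint i).indicator (hc (measurableSet_singleton i))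
  have hval (i : ι) : ∫ ω, (c ⁻¹' {i}).indicator (fun ω => F (X i ω)) ω ∂P =
      P.real (c ⁻¹' {i}) * I := by
    have h := hindep.integral_fun_comp_mul_comp (f := ({i} : Set ι).indicator fun _ => (1 : ℝ))
      (g := fun x : ι → E => F (x i)) hc.aemeasurable (measurable_pi_lambda _ hX).aemeasurable
      (measurable_const.indicator (measurableSet_singleton i)).aestronglyMeasurable
      (hF.comp (measurable_pi_apply i)).aestronglyMeasurable
    rw [hI i] at h
    have e : ∫ ω, ({i} : Set ι).indicator (fun _ => (1 : ℝ)) (c ω) ∂P = P.real (c ⁻¹' {i}) := by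
      rw [← integral_indicator_one (hc (measurableSet_singleton i))]
      rfl
    rw [← e, ← h]
    refine integral_congr_ae (ae_of_all _ fun ω => ?_)
    by_cases hω : c ω = i <;> simp [hω]
  have htotal : ∑ i, P.real (c ⁻¹' {i}) = 1 := by
    rw [sum_measureReal_preimage_singleton _ fun i _ => hc (measurableSet_singleton i)]
    simp
  rw [hsum]
  refine ⟨integrable_finsetSum _ fun i _ => hterm i, ?_⟩
  rw [integral_finsetSum _ fun i _ => hterm i]
  simp_rw [hval]
  rw [← Finset.sum_mul, htotal, one_mul]

/-! ### The ergodic rate -/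

theorem proposition2 {Ω : Type*} [MeasurableSpace Ω] (P : Measure Ω) [IsProbabilityMeasure P]
    {L : ℕ} (free : Finset (Fin L)) (h : Fin L → Ω → ℂ) (c : Ω → Fin L)
    (m lam pw δ : ℝ) (hm : 0 < m) (hlam : 0 < lam) (hpw : 0 < pw) (hδ : 0 < δ)
    (hfading : ∀ l, IsNakagamiFading P m lam (h l))
    (hc : Measurable c) (hfree : ∀ᵐ ω ∂P, c ω ∈ free)
    (hindep : IndepFun c (fun ω l => h l ω) P) :
    Integrable (instantaneousRate free h pw δ c) P ∧
    MeijerGWellDefined 3 1 ![0, 1] ![0, 0, (m : ℂ)] ((δ ^ 2 * m / (pw * lam) : ℝ) : ℂ) ∧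
    ((ergodicRate P free h pw δ c : ℝ) : ℂ) =
      1 / ((Real.Gamma m * Real.log 2 : ℝ) : ℂ) *
        meijerG 3 1 ![0, 1] ![0, 0, (m : ℂ)] ((δ ^ 2 * m / (pw * lam) : ℝ) : ℂ) := by
  have hz : 0 < δ ^ 2 * m / (pw * lam) := by positivity
  have hr : 0 < m / lam := by positivity
  have hg : 0 < pw / δ ^ 2 := by positivity
  let F : ℂ → ℝ := fun w => Real.logb 2 (1 + pw * ‖w‖ ^ 2 / δ ^ 2)
  let f : ℝ → ℝ := fun x => Real.log (1 + pw / δ ^ 2 * x) / Real.log 2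
  have hFf (w : ℂ) : F w = f (‖w‖ ^ 2) := by
    simp only [F, f, Real.logb]
    ring_nf
  have hf : Measurable f := by fun_prop
  have hF : Measurable F := by simp only [F, Real.logb]; fun_prop
  have hfint : Integrable f (gammaMeasure m (m / lam)) :=
    (integrable_log_one_add_gammaMeasure hm hr hg).div_const _
  have hint (l : Fin L) : Integrable (fun ω => F (h l ω)) P := by
    simp_rw [hFf]
    have hl := (hfading l).2
    rw [← hl.map_eq] at hfint
    exact hfint.comp_aemeasurable hl.aemeasurable
  have hI (l : Fin L) : ∫ ω, F (h l ω) ∂P = ∫ x, f x ∂gammaMeasure m (m / lam) := by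
    simp_rw [hFf]
    exact (hfading l).2.integral_comp hf.aestronglyMeasurable
  obtain ⟨hcint, hcval⟩ := integral_randomIndex hc (fun l => (hfading l).1) hF hindep hint hI
  have hae : (fun ω => F (h (c ω) ω)) =ᵐ[P] instantaneousRate free h pw δ c := by
    filter_upwards [hfree] with ω hω
    simp [instantaneousRate, hω, F]
  refine ⟨hcint.congr hae, meijerGWellDefined hm hz, ?_⟩
  rw [ergodicRate, ← integral_congr_ae hae, hcval, integral_div, Complex.ofReal_div,
    integral_log_one_add_gammaMeasure hm hr hg (σ := -1 / 2) (by norm_num) (by norm_num),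
    show m / lam / (pw / δ ^ 2) = δ ^ 2 * m / (pw * lam) by field_simp,
    ← meijerG_eq_line hm hz (by norm_num) (by norm_num)]
  push_cast
  ring
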